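/- Let $N\ge 2$ and $1\le p<\infty$. For an open set $E\subseteq\mathbb{R}^N$ let $C_0^\infty(E)$ be the space of real-valued smooth functions on $\mathbb{R}^N$ with compact support contained in $E$. Define the Poincaré constant \[ \lambda_p(E)=\inf\left\{\int_E|\nabla\varphi|^p\,dx \,:\, \varphi\in C_0^\infty(E),\ \|\varphi\|_{L^p(E)}=1\right\}, \] and, for a compact set $K\subseteq E$, the $p$-capacity of $K$ relative to $E$, \[ \mathrm{cap}_p(K;E)=\inf\left\{\int_E|\nabla u|^p\,dx \,:\, u\in C_0^\infty(E),\ u\ge 1\text{ on }K\right\}. \] For $r>0$ put $Q_r=(-r,r)^N$, and for $\mathbf{t}=(t_1,\dots,t_N)$ with $t_i>0$ for every $i$, put $D_{\mathbf{t}}(x)=(t_1x_1,\dots,t_Nx_N)$. Given such a $\mathbf{t}$ and a nonempty compact set $K\subsetneq\overline{Q_{1/2}}$, the $\mathbf{t}$-periodically perforated open set generated by $K$ is \[ \Omega=\mathbb{R}^N\setminus\bigcup_{\mathbf{i}\in\mathbb{Z}^N}D_{\mathbf{t}}(\mathbf{i}+K). \] There exists a constant $c_{N,p}>0$, depending only on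 $N$ and $p$, such that for every such $\mathbf{t}$ and $K$, with $\Omega$ the $\mathbf{t}$-periodically perforated open set generated by $K$, one has \[ \lambda_p(\Omega)>0\quad\Longleftrightarrow\quad \mathrm{cap}_p(K;Q_1)>0, \] and \[ \lambda_p(\Omega)\ge c_{N,p}\left(\frac{1}{\max\{t_1,\dots,t_N\}}\right)^p\mathrm{cap}_p(K;Q_1). \] -/

import Mathlib

open MeasureTheory
open scoped ContDiff ENNReal

namespace Perforated

/-- The space `C₀^∞(E)` of real-valued smooth functions on `ℝᴺ` whose support is compact and
contained in `E`. -/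
def testFunctions {N : ℕ} (E : Set (EuclideanSpace ℝ (Fin N))) :
    Set (EuclideanSpace ℝ (Fin N) → ℝ) :=
  {φ | ContDiff ℝ ∞ φ ∧ HasCompactSupport φ ∧ tsupport φ ⊆ E}

/-- The `p`-Dirichlet integral `∫_E |∇φ|^p dx`. -/
noncomputable def dirichletIntegral {N : ℕ} (p : ℝ) (E : Set (EuclideanSpace ℝ (Fin N)))
    (φ : EuclideanSpace ℝ (Fin N) → ℝ) : ℝ≥0∞ :=
  ∫⁻ x in E, ‖gradient φ x‖ₑ ^ p

/-- The sharp Poincaré constant `λ_p(Ω)`: the infimum of `∫_Ω |∇φ|^p dx` over all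
`φ ∈ C₀^∞(Ω)` with `‖φ‖_{L^p(Ω)} = 1`. -/
noncomputable def poincareConst {N : ℕ} (p : ℝ) (Ω : Set (EuclideanSpace ℝ (Fin N))) : ℝ≥0∞ :=
  ⨅ φ ∈ {φ ∈ testFunctions Ω | eLpNorm φ (ENNReal.ofReal p) (volume.restrict Ω) = 1},
    dirichletIntegral p Ω φ

/-- The `p`-capacity `cap_p(K; E)` of `K` relative to `E`: the infimum of `∫_E |∇u|^p dx` over all
`u ∈ C₀^∞(E)` with `u ≥ 1` on `K`. -/
noncomputable def relCapacity {N : ℕ} (p : ℝ) (K E : Set (EuclideanSpace ℝ (Fin N))) : ℝ≥0∞ :=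
  ⨅ u ∈ {u ∈ testFunctions E | ∀ x ∈ K, 1 ≤ u x}, dirichletIntegral p E u

/-- The open cube `Q_r = (-r, r)ᴺ`. -/
def cube (N : ℕ) (r : ℝ) : Set (EuclideanSpace ℝ (Fin N)) :=
  {x | ∀ j, x j ∈ Set.Ioo (-r) r}

/-- The diagonal map `D_t(x) = (t₁ x₁, …, t_N x_N)`. -/
noncomputable def dilation {N : ℕ} (t : Fin N → ℝ) (x : EuclideanSpace ℝ (Fin N)) :
    EuclideanSpace ℝ (Fin N) :=
  WithLp.toLp 2 (fun j => t j * x j)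

/-- An integer vector, seen as a point of `ℝᴺ`. -/
noncomputable def latticePoint {N : ℕ} (i : Fin N → ℤ) : EuclideanSpace ℝ (Fin N) :=
  WithLp.toLp 2 (fun j => (i j : ℝ))

/-- The set `ℝᴺ \ ⋃_{i ∈ ℤᴺ} D_t(i + K)`. -/
def perforatedSet {N : ℕ} (t : Fin N → ℝ) (K : Set (EuclideanSpace ℝ (Fin N))) :
    Set (EuclideanSpace ℝ (Fin N)) :=
  (⋃ i : Fin N → ℤ, dilation t '' ((fun x => latticePoint i + x) '' K))ᶜ

/-- `Ω` is a `t`-periodically perforated open set generated by `K`: all the `t_j` are positive, `K`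
is a nonempty compact proper subset of the closed cube `closure Q_{1/2}`, and
`Ω = ℝᴺ \ ⋃_{i ∈ ℤᴺ} D_t(i + K)` (such a set is automatically open). -/
structure IsPeriodicallyPerforated {N : ℕ} (t : Fin N → ℝ)
    (K Ω : Set (EuclideanSpace ℝ (Fin N))) : Prop where
  pos : ∀ j, 0 < t j
  isCompact : IsCompact K
  nonempty : K.Nonempty
  ssubset : K ⊂ closure (cube N (1 / 2))
  eq_perforatedSet : Ω = perforatedSet t K

end Perforated

/-! Lower bound. On a bounded convex set, Jensen's inequality along segments gives a Poincaré
inequality for the deviation of `v` from some constant `m`. If `v` vanishes on `K` and `η` is a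
cutoff, then `η (m - v) / m` competes for the capacity of `K`, so `cap * |m| ^ p` is controlled by
the gradient of `v`. Together these give the Maz'ya-type estimate
`exists_relCapacity_mul_lintegral_le` on `Q₁`. Summing over the integer translates of `Q₁`, which
cover space with overlap at most `2 ^ N`, makes it global; substituting `D_t` costs a factor `(max
t_j) ^ p`, while the Jacobian cancels.

Vanishing. Suppose the capacity is zero. A compactly supported `χ` with values in `[0, 1]` meets
only finitely many holes, and `exists_eq_one_near_translates` provides a `w` equal to `1` near them;
its gradient, and by Friedrichs also `w` itself, is arbitrarily small in `L^p`. Testing the Poincaré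
inequality with `χ (1 - w)` and letting `w` tend to `0` removes the holes: `min λ 1 * ∫ χ ^ p ≤ B ∫
|∇χ| ^ p`, with `B` independent of `χ`. Stretching a fixed cutoff by `R` shrinks the right side by
`R ^ (-p)` relative to the left, which forces `λ = 0`. -/

namespace Perforated

/-! ### Poincaré inequalities on convex sets -/

section Poincare

variable {E : Type*} [NormedAddCommGroup E] [NormedSpace ℝ E]

/-- Jensen's inequality along a segment. -/
theorem enorm_sub_rpow_le_lintegral_fderiv {v : E → ℝ} (hv : ContDiff ℝ 1 v) {p : ℝ} (hp : 1 ≤ p)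
    (x y : E) :
    ‖v x - v y‖ₑ ^ p ≤
      ‖x - y‖ₑ ^ p * ∫⁻ s in Set.Icc (0 : ℝ) 1, ‖fderiv ℝ v (y + s • (x - y))‖ₑ ^ p := by
  have hp0 : 0 < p := by linarith
  set γ : ℝ → E := fun s => y + s • (x - y) with hγ
  have hγd : ∀ s, HasDerivAt γ (x - y) s := fun s => by
    have := ((hasDerivAt_id s).smul_const (x - y)).const_add y
    rwa [one_smul] at this
  have hd : ∀ s, HasDerivAt (v ∘ γ) (fderiv ℝ v (γ s) (x - y)) s := fun s =>
    ((hv.differentiable one_ne_zero) (γ s)).hasFDerivAt.comp_hasDerivAt s (hγd s)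
  have hγc : ContDiff ℝ 1 γ := by fun_prop
  have hcont : Continuous fun s => fderiv ℝ v (γ s) :=
    (hv.continuous_fderiv one_ne_zero).comp hγc.continuous
  have h1 : ‖v x - v y‖ₑ ≤ ‖x - y‖ₑ * ∫⁻ s in Set.Icc (0 : ℝ) 1, ‖fderiv ℝ v (γ s)‖ₑ := by
    have := enorm_sub_le_lintegral_deriv_of_contDiffOn_Icc (f := v ∘ γ) (a := 0) (b := 1)
      (hv.comp hγc).contDiffOn zero_le_one
    have e : (v ∘ γ) 1 - (v ∘ γ) 0 = v x - v y := by simp [hγ]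
    rw [e] at this
    refine this.trans ?_
    rw [← lintegral_const_mul _ hcont.enorm.measurable]
    refine lintegral_mono fun s => ?_
    rw [(hd s).deriv, mul_comm]
    exact (fderiv ℝ v (γ s)).le_opENorm _
  refine (ENNReal.rpow_le_rpow h1 hp0.le).trans ?_
  rw [ENNReal.mul_rpow_of_nonneg _ _ hp0.le]
  gcongr
  -- Jensen takes the form of monotonicity of `L^q` norms in `q` on a probability space.
  have : IsProbabilityMeasure (volume.restrict (Set.Icc (0 : ℝ) 1)) := ⟨by simp⟩
  have hj := eLpNorm_le_eLpNorm_of_exponent_le (μ := volume.restrict (Set.Icc (0 : ℝ) 1))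
    (p := 1) (q := ENNReal.ofReal p) (by simpa using hp) hcont.aestronglyMeasurable
  rw [eLpNorm_one_eq_lintegral_enorm, eLpNorm_eq_lintegral_rpow_enorm_toReal
    (by simpa using hp0) ENNReal.ofReal_ne_top, ENNReal.toReal_ofReal hp0.le] at hj
  refine (ENNReal.rpow_le_rpow hj hp0.le).trans_eq ?_
  rw [← ENNReal.rpow_mul, one_div, inv_mul_cancel₀ hp0.ne', ENNReal.rpow_one]

variable [FiniteDimensional ℝ E] [MeasurableSpace E] [BorelSpace E] (μ : Measure E)
  [μ.IsAddHaarMeasure]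

theorem lintegral_comp_smul_add {g : E → ℝ≥0∞} {s : ℝ} (hs : s ≠ 0) (c : E) :
    ∫⁻ x, g (s • x + c) ∂μ =
      ENNReal.ofReal |(s ^ Module.finrank ℝ E)⁻¹| * ∫⁻ x, g x ∂μ := by
  have h := (Homeomorph.smulOfNeZero s hs (α := E)).measurableEmbedding.lintegral_map
    (μ := μ) (fun x => g (x + c))
  have e : (⇑(Homeomorph.smulOfNeZero s hs (α := E))) = (s • ·) := rfl
  rw [e, Measure.map_addHaar_smul μ hs, lintegral_smul_measure,
    lintegral_add_right_eq_self] at h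
  simpa using h.symm

/-- Contraction towards `y` keeps the convex set `Q` inside itself, and the Jacobian `s ^ (-n)` is
at most `2 ^ n` because `s ≥ 1 / 2`. -/
theorem lintegral_convex_comb_le {Q : Set E} (hQ : Convex ℝ Q) (hQm : MeasurableSet Q)
    (g : E → ℝ≥0∞) {s : ℝ} (hs : s ∈ Set.Icc (1 / 2 : ℝ) 1) {y : E} (hy : y ∈ Q) :
    ∫⁻ x in Q, g (y + s • (x - y)) ∂μ ≤ 2 ^ Module.finrank ℝ E * ∫⁻ x in Q, g x ∂μ := by
  have hs0 : 0 < s := by linarith [hs.1]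
  calc ∫⁻ x in Q, g (y + s • (x - y)) ∂μ
      ≤ ∫⁻ x in Q, Q.indicator g (s • x + (1 - s) • y) ∂μ := by
        refine setLIntegral_mono' hQm fun x hx => ?_
        have e : y + s • (x - y) = s • x + (1 - s) • y := by module
        have hmem : s • x + (1 - s) • y ∈ Q :=
          hQ hx hy hs0.le (by linarith [hs.2]) (by ring)
        rw [e, Set.indicator_of_mem hmem]
    _ ≤ ∫⁻ x, Q.indicator g (s • x + (1 - s) • y) ∂μ := setLIntegral_le_lintegral _ _
    _ = ENNReal.ofReal |(s ^ Module.finrank ℝ E)⁻¹| * ∫⁻ x in Q, g x ∂μ := by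
        rw [lintegral_comp_smul_add μ hs0.ne', lintegral_indicator hQm]
    _ ≤ 2 ^ Module.finrank ℝ E * ∫⁻ x in Q, g x ∂μ := by
        gcongr
        rw [abs_of_pos (by positivity), ← inv_pow, ENNReal.ofReal_pow (by positivity)]
        gcongr
        rw [← ENNReal.ofReal_ofNat]
        refine ENNReal.ofReal_le_ofReal ?_
        rw [inv_le_comm₀ hs0 two_pos]
        linarith [hs.1]

/-- The double-integral form of the Poincaré inequality on a bounded convex set. -/
theorem lintegral_lintegral_enorm_sub_rpow_le {Q : Set E} (hQ : Convex ℝ Q)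
    (hQm : MeasurableSet Q) {d : ℝ≥0∞} (hd : ∀ x ∈ Q, ∀ y ∈ Q, ‖x - y‖ₑ ≤ d)
    {v : E → ℝ} (hv : ContDiff ℝ 1 v) {p : ℝ} (hp : 1 ≤ p) :
    ∫⁻ y in Q, ∫⁻ x in Q, ‖v x - v y‖ₑ ^ p ∂μ ∂μ ≤
      d ^ p * (2 ^ Module.finrank ℝ E * μ Q) * ∫⁻ x in Q, ‖fderiv ℝ v x‖ₑ ^ p ∂μ := by
  have hp0 : 0 ≤ p := by linarith
  set g : E → ℝ≥0∞ := fun x => ‖fderiv ℝ v x‖ₑ ^ p with hg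
  have hgc : Continuous g :=
    ENNReal.continuous_rpow_const.comp (hv.continuous_fderiv one_ne_zero).enorm
  set I : ℝ≥0∞ := ∫⁻ x in Q, g x ∂μ
  have key : ∀ s ∈ Set.Icc (0 : ℝ) 1, ∫⁻ y in Q, ∫⁻ x in Q, g (y + s • (x - y)) ∂μ ∂μ ≤
      2 ^ Module.finrank ℝ E * I * μ Q := by
    intro s hs
    rcases le_total (1 / 2) s with h | h
    · calc _ ≤ ∫⁻ y in Q, 2 ^ Module.finrank ℝ E * I ∂μ :=
            setLIntegral_mono' hQm fun y hy =>
              lintegral_convex_comb_le μ hQ hQm g ⟨h, hs.2⟩ hy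
        _ = _ := by simp
    -- For `s ≤ 1 / 2` the substitution in `x` degenerates; exchanging the roles of `x` and `y`
    -- replaces `s` by `1 - s ≥ 1 / 2`.
    · rw [lintegral_lintegral_swap (by fun_prop)]
      calc _ ≤ ∫⁻ y in Q, 2 ^ Module.finrank ℝ E * I ∂μ := by
            refine setLIntegral_mono' hQm fun y hy => ?_
            refine le_trans (le_of_eq ?_) (lintegral_convex_comb_le μ hQ hQm g
              (s := 1 - s) ⟨by linarith, by linarith [hs.1]⟩ hy)
            congr! 3 with x
            module
        _ = _ := by simp
  calc _ ≤ ∫⁻ y in Q, ∫⁻ x in Q, d ^ p * (∫⁻ s in Set.Icc (0 : ℝ) 1, g (y + s • (x - y))) ∂μ ∂μ := by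
        refine setLIntegral_mono' hQm fun y hy => setLIntegral_mono' hQm fun x hx => ?_
        refine (enorm_sub_rpow_le_lintegral_fderiv hv hp x y).trans ?_
        gcongr
        exact hd x hx y hy
    _ = d ^ p * ∫⁻ s in Set.Icc (0 : ℝ) 1, ∫⁻ y in Q, ∫⁻ x in Q, g (y + s • (x - y)) ∂μ ∂μ := by
        have h1 : ∀ y, ∫⁻ x in Q, d ^ p * (∫⁻ s in Set.Icc (0 : ℝ) 1, g (y + s • (x - y))) ∂μ =
            d ^ p * ∫⁻ s in Set.Icc (0 : ℝ) 1, ∫⁻ x in Q, g (y + s • (x - y)) ∂μ := fun y => by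
          rw [lintegral_const_mul, lintegral_lintegral_swap]
          · fun_prop
          · have : Continuous fun z : E × ℝ => g (y + z.2 • (z.1 - y)) := by fun_prop
            exact this.measurable.lintegral_prod_right'
        simp_rw [h1]
        have hm : Measurable fun z : (E × ℝ) => ∫⁻ x in Q, g (z.1 + z.2 • (x - z.1)) ∂μ := by
          have : Continuous fun z : (E × ℝ) × E => g (z.1.1 + z.1.2 • (z.2 - z.1.1)) := by
            fun_prop
          exact this.measurable.lintegral_prod_right'
        rw [lintegral_const_mul, lintegral_lintegral_swap hm.aemeasurable]
        exact hm.lintegral_prod_right'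
    _ ≤ d ^ p * ∫⁻ s in Set.Icc (0 : ℝ) 1, 2 ^ Module.finrank ℝ E * I * μ Q := by
        refine mul_le_mul_right ?_ _
        exact setLIntegral_mono' measurableSet_Icc key
    _ = _ := by simp; ring

/-- The Poincaré inequality on a bounded convex set, with the mean replaced by some constant. -/
theorem exists_lintegral_enorm_sub_rpow_le {Q : Set E} (hQ : Convex ℝ Q)
    (hQm : MeasurableSet Q) (hQ0 : μ Q ≠ 0) (hQt : μ Q ≠ ⊤) {d : ℝ≥0∞}
    (hd : ∀ x ∈ Q, ∀ y ∈ Q, ‖x - y‖ₑ ≤ d) {v : E → ℝ} (hv : ContDiff ℝ 1 v) {p : ℝ}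
    (hp : 1 ≤ p) :
    ∃ m : ℝ, ∫⁻ x in Q, ‖v x - m‖ₑ ^ p ∂μ ≤
      d ^ p * 2 ^ Module.finrank ℝ E * ∫⁻ x in Q, ‖fderiv ℝ v x‖ₑ ^ p ∂μ := by
  have hvc := hv.continuous
  have hm : Measurable fun y => ∫⁻ x in Q, ‖v x - v y‖ₑ ^ p ∂μ := by
    have : Continuous fun z : E × E => ‖v z.2 - v z.1‖ₑ ^ p :=
      ENNReal.continuous_rpow_const.comp (by fun_prop)
    exact this.measurable.lintegral_prod_right'
  -- Some `y` does no worse than the average of the double integral, so `v y` can replace the mean.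
  obtain ⟨y, -, hy⟩ := exists_le_setLAverage hQ0 hQt hm.aemeasurable
  refine ⟨v y, hy.trans ?_⟩
  rw [setLAverage_eq]
  refine ENNReal.div_le_of_le_mul
    ((lintegral_lintegral_enorm_sub_rpow_le μ hQ hQm hd hv hp).trans_eq (by ring))

end Poincare

/-! ### Topology and measure of cubes -/

section Cube

variable {N : ℕ}

theorem isOpen_cube (r : ℝ) : IsOpen (cube N r) := by
  have : cube N r = ⋂ j, {x | x j ∈ Set.Ioo (-r) r} := by ext; simp [cube]
  rw [this]
  exact isOpen_iInter_of_finite fun j => isOpen_Ioo.preimage (by fun_prop)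

theorem convex_cube (r : ℝ) : Convex ℝ (cube N r) := fun _ hx _ hy _ _ ha hb hab j =>
  convex_Ioo (-r) r (hx j) (hy j) ha hb hab

theorem isCompact_closedCube (r : ℝ) :
    IsCompact {x : EuclideanSpace ℝ (Fin N) | ∀ j, x j ∈ Set.Icc (-r) r} := by
  have h : IsCompact (Set.univ.pi fun _ : Fin N => Set.Icc (-r) r) :=
    isCompact_univ_pi fun _ => isCompact_Icc
  have := h.image (PiLp.continuous_toLp 2 fun _ : Fin N => ℝ)
  convert this using 1
  ext x
  constructor
  · intro hx
    exact ⟨x.ofLp, fun j _ => hx j, rfl⟩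
  · rintro ⟨y, hy, rfl⟩ j
    exact hy j trivial

theorem cube_subset_closedCube (r : ℝ) : cube N r ⊆ {x | ∀ j, x j ∈ Set.Icc (-r) r} :=
  fun _ hx j => Set.Ioo_subset_Icc_self (hx j)

theorem closure_cube_subset (r : ℝ) : closure (cube N r) ⊆ {x | ∀ j, x j ∈ Set.Icc (-r) r} :=
  closure_minimal (cube_subset_closedCube r) (isCompact_closedCube r).isClosed

theorem isBounded_cube (r : ℝ) : Bornology.IsBounded (cube N r) :=
  (isCompact_closedCube r).isBounded.subset (cube_subset_closedCube r)

theorem volume_cube_ne_top (r : ℝ) : volume (cube N r) ≠ ⊤ := (isBounded_cube r).measure_lt_top.ne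

theorem zero_mem_cube {r : ℝ} (hr : 0 < r) : (0 : EuclideanSpace ℝ (Fin N)) ∈ cube N r :=
  fun _ => ⟨by simpa using hr, by simpa using hr⟩

theorem volume_cube_ne_zero {r : ℝ} (hr : 0 < r) : volume (cube N r) ≠ 0 :=
  ((isOpen_cube r).measure_pos _ ⟨0, zero_mem_cube hr⟩).ne'

theorem enorm_sub_le_ediam_cube (r : ℝ) :
    ∀ x ∈ cube N r, ∀ y ∈ cube N r, ‖x - y‖ₑ ≤ Metric.ediam (cube N r) := fun x hx y hy => by
  rw [← edist_eq_enorm_sub]; exact Metric.edist_le_ediam_of_mem hx hy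

end Cube

/-! ### Capacity and Friedrichs inequalities on the unit cube -/

section TestFunctions

variable {N : ℕ} {p : ℝ} {U : Set (EuclideanSpace ℝ (Fin N))}
  {φ : EuclideanSpace ℝ (Fin N) → ℝ}

theorem dirichletIntegral_eq (p : ℝ) (U : Set (EuclideanSpace ℝ (Fin N)))
    (φ : EuclideanSpace ℝ (Fin N) → ℝ) :
    dirichletIntegral p U φ = ∫⁻ x in U, ‖fderiv ℝ φ x‖ₑ ^ p := by
  unfold dirichletIntegral gradient
  congr! 3 with x
  rw [← ofReal_norm, ← ofReal_norm, LinearIsometryEquiv.norm_map]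

theorem dirichletIntegral_eq_lintegral (hp : 0 < p) (hφ : φ ∈ testFunctions U) :
    dirichletIntegral p U φ = ∫⁻ x, ‖fderiv ℝ φ x‖ₑ ^ p := by
  rw [dirichletIntegral_eq]
  refine setLIntegral_eq_of_support_subset fun x hx => hφ.2.2 ?_
  refine support_fderiv_subset ℝ (f := φ) fun h => hx ?_
  have h0 : ‖fderiv ℝ φ x‖ₑ = 0 := by rw [h, ← ofReal_norm, norm_zero, ENNReal.ofReal_zero]
  simp [h0, hp]

theorem lintegral_enorm_rpow_lt_top {F : Type*} [NormedAddCommGroup F]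
    {f : EuclideanSpace ℝ (Fin N) → F} (hf : Continuous f) (hc : HasCompactSupport f)
    (hp : 0 < p) : ∫⁻ x, ‖f x‖ₑ ^ p < ⊤ := by
  have := (hf.memLp_of_hasCompactSupport (p := ENNReal.ofReal p) (μ := volume) hc).eLpNorm_lt_top
  simpa [hp.le] using lintegral_rpow_enorm_lt_top_of_eLpNorm_lt_top (by simpa using hp)
    ENNReal.ofReal_ne_top this

theorem exists_enorm_fderiv_le (hφ : ContDiff ℝ ∞ φ) (hc : HasCompactSupport φ) :
    ∃ M : ℝ≥0∞, M ≠ ⊤ ∧ ∀ x, ‖fderiv ℝ φ x‖ₑ ≤ M := by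
  obtain ⟨M, hM⟩ := (hφ.continuous_fderiv (by simp)).bounded_above_of_compact_support
    (hc.fderiv ℝ)
  refine ⟨ENNReal.ofReal M, ENNReal.ofReal_ne_top, fun x => ?_⟩
  rw [← ofReal_norm]
  exact ENNReal.ofReal_le_ofReal (hM x)

/-- A smooth cutoff between the cubes of half-sides `1 / 2` and `1`. -/
theorem exists_cutoff (N : ℕ) : ∃ η ∈ testFunctions (cube N 1),
    (∀ x ∈ closure (cube N (1 / 2)), η x = 1) ∧ ∀ x, η x ∈ Set.Icc (0 : ℝ) 1 := by
  -- The intermediate half-side `3 / 4` keeps the closed support inside the open cube `Q₁`.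
  have hsub : closure (cube N (1 / 2)) ⊆
      interior {x | ∀ j, x j ∈ Set.Icc (-(3 / 4 : ℝ)) (3 / 4)} := by
    refine (closure_cube_subset _).trans (Set.Subset.trans ?_
      (interior_maximal (cube_subset_closedCube (N := N) (3 / 4)) (isOpen_cube _)))
    intro x hx j
    have := hx j
    simp only [Set.mem_Icc, Set.mem_Ioo] at this ⊢
    constructor <;> linarith
  obtain ⟨f, h1, h0, hr⟩ := exists_contMDiffMap_one_nhds_of_subset_interior
    (n := (⊤ : ℕ∞)) (modelWithCornersSelf ℝ (EuclideanSpace ℝ (Fin N))) isClosed_closure hsub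
  have hts : tsupport f ⊆ {x | ∀ j, x j ∈ Set.Icc (-(3 / 4 : ℝ)) (3 / 4)} :=
    closure_minimal (fun x hx => by_contra fun h => hx (h0 x h)) (isCompact_closedCube _).isClosed
  refine ⟨f, ⟨f.contMDiff.contDiff, (isCompact_closedCube _).of_isClosed_subset
    (isClosed_tsupport _) hts, hts.trans ?_⟩, fun x hx => h1.self_of_nhdsSet x hx, hr⟩
  intro x hx j
  have := hx j
  simp only [Set.mem_Icc, Set.mem_Ioo] at this ⊢
  constructor <;> linarith

theorem relCapacity_le {K : Set (EuclideanSpace ℝ (Fin N))} (hφ : φ ∈ testFunctions U)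
    (h : ∀ x ∈ K, 1 ≤ φ x) : relCapacity p K U ≤ dirichletIntegral p U φ :=
  iInf₂_le φ ⟨hφ, h⟩

/-- The Maz'ya–Poincaré inequality on the cube `Q₁`. -/
theorem exists_relCapacity_mul_lintegral_le (N : ℕ) {p : ℝ} (hp : 1 ≤ p) :
    ∃ C : ℝ≥0∞, C ≠ ⊤ ∧ ∀ K ⊆ closure (cube N (1 / 2)),
      ∀ v : EuclideanSpace ℝ (Fin N) → ℝ, ContDiff ℝ ∞ v →
      (∀ x ∈ K, v x = 0) →
      relCapacity p K (cube N 1) * ∫⁻ x in cube N 1, ‖v x‖ₑ ^ p ≤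
        C * ∫⁻ x in cube N 1, ‖fderiv ℝ v x‖ₑ ^ p := by
  have hp0 : 0 < p := by linarith
  obtain ⟨η, hη, hη1, hηr⟩ := exists_cutoff N
  obtain ⟨M, hMt, hM⟩ := exists_enorm_fderiv_le hη.1 hη.2.1
  set Q := cube N 1 with hQ
  set B : ℝ≥0∞ := dirichletIntegral p Q η with hB
  have hBt : B ≠ ⊤ := by
    rw [hB, dirichletIntegral_eq_lintegral hp0 hη]
    exact (lintegral_enorm_rpow_lt_top (hη.1.continuous_fderiv (by simp))
      (hη.2.1.fderiv ℝ) hp0).ne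
  set C₁ : ℝ≥0∞ := Metric.ediam Q ^ p * 2 ^ Module.finrank ℝ (EuclideanSpace ℝ (Fin N)) with hC₁
  have hC₁t : C₁ ≠ ⊤ := ENNReal.mul_ne_top
    (ENNReal.rpow_ne_top_of_nonneg hp0.le (isBounded_cube 1).ediam_ne_top) (by simp)
  have h2t : (2 : ℝ≥0∞) ^ (p - 1) ≠ ⊤ :=
    ENNReal.rpow_ne_top_of_nonneg (by linarith) (by simp)
  have hVt : volume Q ≠ ⊤ := volume_cube_ne_top 1
  have hMpt : M ^ p ≠ ⊤ := ENNReal.rpow_ne_top_of_nonneg hp0.le hMt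
  refine ⟨2 ^ (p - 1) * (B * C₁ + volume Q * (2 ^ (p - 1) * (1 + M ^ p * C₁))), by finiteness,
    fun K hK v hv hvK => ?_⟩
  have hv1 : ContDiff ℝ 1 v := hv.of_le (by simp)
  have hvd : Differentiable ℝ v := hv1.differentiable one_ne_zero
  have hηd : Differentiable ℝ η := hη.1.differentiable (by simp)
  obtain ⟨m, hm⟩ := exists_lintegral_enorm_sub_rpow_le volume (convex_cube 1)
    (isOpen_cube 1).measurableSet (volume_cube_ne_zero one_pos) hVt (enorm_sub_le_ediam_cube 1)
    hv1 hp
  rw [← hQ, ← hC₁] at hm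
  set G : ℝ≥0∞ := ∫⁻ x in Q, ‖fderiv ℝ v x‖ₑ ^ p with hG
  set A : ℝ≥0∞ := ∫⁻ x in Q, ‖v x - m‖ₑ ^ p with hA
  have hGm : Measurable fun x => ‖fderiv ℝ v x‖ₑ ^ p :=
    ((hv1.continuous_fderiv one_ne_zero).enorm.measurable).pow_const p
  have hAm : Measurable fun x => ‖v x - m‖ₑ ^ p :=
    ((hv1.continuous.sub continuous_const).enorm.measurable).pow_const p
  set cap := relCapacity p K Q with hcap
  have hcapB : cap ≤ B := relCapacity_le hη fun x hx => (hη1 x (hK hx)).ge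
  have hcapm : ‖m‖ₑ ^ p * cap ≤ 2 ^ (p - 1) * (G + M ^ p * A) := by
    rcases eq_or_ne m 0 with rfl | hm0
    · simp [hp0]
    -- On `K`, where `v = 0` and `η = 1`, this function equals `1`; the cutoff supplies the compact
    -- support in `Q₁`.
    have hu : (fun x => m⁻¹ * (η x * (m - v x))) ∈ testFunctions Q := by
      have hts : tsupport (fun x => m⁻¹ * (η x * (m - v x))) ⊆ tsupport η :=
        closure_mono fun x hx h => hx (by simp [h])
      refine ⟨contDiff_const.mul (hη.1.mul (contDiff_const.sub hv)),
        hη.2.1.of_isClosed_subset (isClosed_tsupport _) hts, hts.trans hη.2.2⟩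
    have hle : cap ≤ _ := relCapacity_le (p := p) (K := K) hu fun x hx => by
      simp [hvK x hx, hη1 x (hK hx), hm0]
    rw [dirichletIntegral_eq] at hle
    have hpt : ∀ x, ‖fderiv ℝ (fun x => m⁻¹ * (η x * (m - v x))) x‖ₑ ^ p ≤
        ‖m⁻¹‖ₑ ^ p * (2 ^ (p - 1) * (‖fderiv ℝ v x‖ₑ ^ p + M ^ p * ‖v x - m‖ₑ ^ p)) := by
      intro x
      have hder : fderiv ℝ (fun x => m⁻¹ * (η x * (m - v x))) x =
          m⁻¹ • (η x • (-fderiv ℝ v x) + (m - v x) • fderiv ℝ η x) :=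
        (((hηd x).hasFDerivAt.mul ((hvd x).hasFDerivAt.const_sub m)).const_mul m⁻¹).fderiv
      rw [hder, enorm_smul, ENNReal.mul_rpow_of_nonneg _ _ hp0.le]
      gcongr
      rw [← ENNReal.mul_rpow_of_nonneg _ _ hp0.le]
      refine le_trans ?_ (ENNReal.rpow_add_le_mul_rpow_add_rpow _ _ hp)
      gcongr
      refine (enorm_add_le (η x • (-fderiv ℝ v x)) ((m - v x) • fderiv ℝ η x)).trans ?_
      rw [enorm_smul, enorm_smul, enorm_neg, mul_comm M, enorm_sub_rev (v x)]
      gcongr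
      · refine mul_le_of_le_one_left' ?_
        rw [Real.enorm_eq_ofReal (hηr x).1]
        exact ENNReal.ofReal_le_one.2 (hηr x).2
      · exact hM x
    have hle2 : cap ≤ ‖m⁻¹‖ₑ ^ p * (2 ^ (p - 1) * (G + M ^ p * A)) := by
      refine hle.trans ((lintegral_mono hpt).trans_eq ?_)
      rw [lintegral_const_mul _ (by fun_prop), lintegral_const_mul _ (by fun_prop),
        lintegral_add_left hGm, lintegral_const_mul _ hAm]
    calc ‖m‖ₑ ^ p * cap ≤ ‖m‖ₑ ^ p * (‖m⁻¹‖ₑ ^ p * (2 ^ (p - 1) * (G + M ^ p * A))) := by gcongr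
      _ = _ := by
        rw [← mul_assoc, ← ENNReal.mul_rpow_of_nonneg _ _ hp0.le, ← enorm_mul,
          mul_inv_cancel₀ hm0]
        simp
  have hV : ∫⁻ x in Q, ‖v x‖ₑ ^ p ≤ 2 ^ (p - 1) * (A + ‖m‖ₑ ^ p * volume Q) := by
    calc ∫⁻ x in Q, ‖v x‖ₑ ^ p
        ≤ ∫⁻ x in Q, 2 ^ (p - 1) * (‖v x - m‖ₑ ^ p + ‖m‖ₑ ^ p) := by
          refine lintegral_mono fun x => ?_
          refine le_trans ?_ (ENNReal.rpow_add_le_mul_rpow_add_rpow _ _ hp)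
          gcongr
          simpa using enorm_add_le (v x - m) m
      _ = _ := by
          rw [lintegral_const_mul _ (by fun_prop), lintegral_add_left hAm,
            setLIntegral_const]
  -- The deviation term is paid for by the crude bound `cap ≤ B`, the constant term by `hcapm`.
  calc cap * ∫⁻ x in Q, ‖v x‖ₑ ^ p
      ≤ cap * (2 ^ (p - 1) * (A + ‖m‖ₑ ^ p * volume Q)) := by gcongr
    _ = 2 ^ (p - 1) * (cap * A + volume Q * (‖m‖ₑ ^ p * cap)) := by ring
    _ ≤ 2 ^ (p - 1) * (B * (C₁ * G) +
          volume Q * (2 ^ (p - 1) * (G + M ^ p * (C₁ * G)))) := by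
        exact mul_le_mul' le_rfl (add_le_add (mul_le_mul' hcapB hm)
          (mul_le_mul' le_rfl (hcapm.trans (by gcongr))))
    _ = _ := by ring

/-- The Friedrichs inequality for functions supported in the cube `Q₁`. -/
theorem exists_lintegral_le_dirichletIntegral (hN : 0 < N) {p : ℝ} (hp : 1 ≤ p) :
    ∃ C : ℝ≥0∞, C ≠ ⊤ ∧ ∀ u ∈ testFunctions (cube N 1),
      ∫⁻ x, ‖u x‖ₑ ^ p ≤ C * ∫⁻ x, ‖fderiv ℝ u x‖ₑ ^ p := by
  have hp0 : 0 < p := by linarith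
  -- In this shell `u` vanishes, so restricting `y` to it in the double integral of `|u x - u y| ^
  -- p` leaves `volume W` times the integral of `|u| ^ p`.
  set W : Set (EuclideanSpace ℝ (Fin N)) := cube N 2 \ {x | ∀ j, x j ∈ Set.Icc (-1 : ℝ) 1}
  have hWo : IsOpen W := (isOpen_cube 2).sdiff (isCompact_closedCube 1).isClosed
  have hW0 : volume W ≠ 0 := by
    refine (hWo.measure_pos _ ⟨WithLp.toLp 2 fun _ => 3 / 2, fun j => ?_, fun h => ?_⟩).ne'
    · simp; norm_num
    · have := (h ⟨0, hN⟩).2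
      norm_num at this
  set D : ℝ≥0∞ := Metric.ediam (cube N 2) ^ p *
    (2 ^ Module.finrank ℝ (EuclideanSpace ℝ (Fin N)) * volume (cube N 2))
  have hDt : D ≠ ⊤ := ENNReal.mul_ne_top
    (ENNReal.rpow_ne_top_of_nonneg hp0.le (isBounded_cube 2).ediam_ne_top)
    (ENNReal.mul_ne_top (by simp) (volume_cube_ne_top 2))
  have hWt : volume W ≠ ⊤ := ((measure_mono Set.sdiff_subset).trans_lt
    (volume_cube_ne_top 2).lt_top).ne
  refine ⟨D / volume W, ENNReal.div_ne_top hDt hW0, fun u hu => ?_⟩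
  rw [← ENNReal.mul_div_right_comm, ENNReal.le_div_iff_mul_le (.inl hW0) (.inl hWt)]
  have hsupp : ∀ x, x ∉ cube N 1 → u x = 0 := fun x hx =>
    image_eq_zero_of_notMem_tsupport fun h => hx (hu.2.2 h)
  have h12 : cube N 1 ⊆ cube N 2 := fun x hx j => by
    have := hx j
    simp only [Set.mem_Ioo] at this ⊢
    constructor <;> linarith
  have hin : ∫⁻ x in cube N 2, ‖u x‖ₑ ^ p = ∫⁻ x, ‖u x‖ₑ ^ p :=
    setLIntegral_eq_of_support_subset fun x hx => by
      by_contra h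
      exact hx (by simp [hsupp x fun h' => h (h12 h'), hp0])
  calc (∫⁻ x, ‖u x‖ₑ ^ p) * volume W
      = ∫⁻ y in W, ∫⁻ x in cube N 2, ‖u x - u y‖ₑ ^ p := by
        rw [← setLIntegral_const]
        refine setLIntegral_congr_fun hWo.measurableSet fun y hy => ?_
        have : u y = 0 := hsupp y fun h => hy.2 (cube_subset_closedCube 1 h)
        simp only [this, sub_zero, hin]
    _ ≤ ∫⁻ y in cube N 2, ∫⁻ x in cube N 2, ‖u x - u y‖ₑ ^ p :=
        lintegral_mono_set Set.sdiff_subset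
    _ ≤ D * ∫⁻ x in cube N 2, ‖fderiv ℝ u x‖ₑ ^ p :=
        lintegral_lintegral_enorm_sub_rpow_le volume (convex_cube 2) (isOpen_cube 2).measurableSet
          (enorm_sub_le_ediam_cube 2) (hu.1.of_le (by simp)) hp
    _ ≤ _ := by
        gcongr
        exact Measure.restrict_le_self

end TestFunctions

variable {N : ℕ}

/-! ### Summation over integer translates of the cube -/

section Lattice

theorem setLIntegral_cube_add (f : EuclideanSpace ℝ (Fin N) → ℝ≥0∞)
    (a : EuclideanSpace ℝ (Fin N)) :
    ∫⁻ x in cube N 1, f (x + a) = ∫⁻ x, ((a + ·) '' cube N 1).indicator f x := by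
  rw [← lintegral_indicator (isOpen_cube 1).measurableSet, ← lintegral_sub_right_eq_self _ a]
  refine lintegral_congr fun x => ?_
  have : x - a ∈ cube N 1 ↔ x ∈ (a + ·) '' cube N 1 := by
    constructor
    · exact fun h => ⟨_, h, by simp⟩
    · rintro ⟨y, hy, rfl⟩
      simpa using hy
  by_cases h : x - a ∈ cube N 1
  · rw [Set.indicator_of_mem h, Set.indicator_of_mem (this.1 h), sub_add_cancel]
  · rw [Set.indicator_of_notMem h, Set.indicator_of_notMem (mt this.2 h)]

theorem mem_latticePoint_add_cube {i : Fin N → ℤ} {x : EuclideanSpace ℝ (Fin N)} :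
    x ∈ (latticePoint i + ·) '' cube N 1 ↔ ∀ j, |x j - i j| < 1 := by
  constructor
  · rintro ⟨y, hy, rfl⟩ j
    simpa [latticePoint, abs_lt] using hy j
  · intro h
    refine ⟨x - latticePoint i, fun j => ?_, by simp⟩
    simpa [latticePoint, abs_lt] using h j

theorem tsum_setLIntegral_cube_add {f : EuclideanSpace ℝ (Fin N) → ℝ≥0∞} (hf : Measurable f) :
    ∑' i : Fin N → ℤ, ∫⁻ x in cube N 1, f (x + latticePoint i) =
      ∫⁻ x, ∑' i : Fin N → ℤ, ((latticePoint i + ·) '' cube N 1).indicator f x := by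
  rw [lintegral_tsum]
  · exact tsum_congr fun i => setLIntegral_cube_add f _
  · intro i
    refine (hf.indicator ?_).aemeasurable
    exact ((Homeomorph.addLeft (latticePoint i)).isOpenMap _ (isOpen_cube 1)).measurableSet

theorem lintegral_le_tsum_cube {f : EuclideanSpace ℝ (Fin N) → ℝ≥0∞} (hf : Measurable f) :
    ∫⁻ x, f x ≤ ∑' i : Fin N → ℤ, ∫⁻ x in cube N 1, f (x + latticePoint i) := by
  rw [tsum_setLIntegral_cube_add hf]
  refine lintegral_mono fun x => ?_
  refine le_trans ?_ (ENNReal.le_tsum fun j => ⌊x j⌋)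
  rw [Set.indicator_of_mem]
  refine mem_latticePoint_add_cube.2 fun j => ?_
  rw [abs_lt]
  have h1 := Int.floor_le (x j)
  have h2 := Int.lt_floor_add_one (x j)
  constructor <;> linarith

/-- Finite overlap: a point lies in the translate by `i` only if each `|x j - i j| < 1`, which
leaves at most two values for each `i j`. -/
theorem tsum_cube_le {f : EuclideanSpace ℝ (Fin N) → ℝ≥0∞} (hf : Measurable f) :
    ∑' i : Fin N → ℤ, ∫⁻ x in cube N 1, f (x + latticePoint i) ≤ 2 ^ N * ∫⁻ x, f x := by
  rw [tsum_setLIntegral_cube_add hf, ← lintegral_const_mul _ hf]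
  refine lintegral_mono fun x => ?_
  set S : Finset (Fin N → ℤ) := Fintype.piFinset fun j => {⌊x j⌋, ⌊x j⌋ + 1} with hS
  rw [tsum_eq_sum (s := S)]
  · calc _ ≤ ∑ i ∈ S, f x := Finset.sum_le_sum fun i _ => Set.indicator_le_self _ _ _
      _ = S.card * f x := by simp
      _ ≤ 2 ^ N * f x := by
        gcongr
        rw [hS, Fintype.card_piFinset]
        have : ∏ j : Fin N, ({⌊x j⌋, ⌊x j⌋ + 1} : Finset ℤ).card ≤ ∏ _j : Fin N, 2 :=
          Finset.prod_le_prod' fun j _ => Finset.card_le_two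
        rw [Finset.prod_const, Finset.card_univ, Fintype.card_fin] at this
        exact_mod_cast this
  · intro i hi
    refine Set.indicator_of_notMem (fun h => hi ?_) _
    rw [hS, Fintype.mem_piFinset]
    intro j
    have h := abs_lt.1 (mem_latticePoint_add_cube.1 h j)
    rw [Finset.mem_insert, Finset.mem_singleton]
    have h1 : i j - 1 ≤ ⌊x j⌋ := Int.le_floor.2 (by push_cast; linarith)
    have h2 : ⌊x j⌋ < i j + 1 := Int.floor_lt.2 (by push_cast; linarith)
    omega

theorem exists_relCapacity_mul_lintegral_le_of_periodic (N : ℕ) {p : ℝ} (hp : 1 ≤ p) :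
    ∃ C : ℝ≥0∞, C ≠ ⊤ ∧ ∀ K ⊆ closure (cube N (1 / 2)),
      ∀ v : EuclideanSpace ℝ (Fin N) → ℝ, ContDiff ℝ ∞ v →
      (∀ i, ∀ x ∈ K, v (latticePoint i + x) = 0) →
      relCapacity p K (cube N 1) * ∫⁻ x, ‖v x‖ₑ ^ p ≤ C * ∫⁻ x, ‖fderiv ℝ v x‖ₑ ^ p := by
  obtain ⟨C, hC, h⟩ := exists_relCapacity_mul_lintegral_le N hp
  refine ⟨C * 2 ^ N, by finiteness, fun K hK v hv hvK => ?_⟩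
  have hm0 : Measurable fun x => ‖v x‖ₑ ^ p := (hv.continuous.enorm.measurable).pow_const p
  have hm1 : Measurable fun x => ‖fderiv ℝ v x‖ₑ ^ p :=
    ((hv.continuous_fderiv (by simp)).enorm.measurable).pow_const p
  calc _ ≤ relCapacity p K (cube N 1) *
        ∑' i : Fin N → ℤ, ∫⁻ x in cube N 1, ‖v (x + latticePoint i)‖ₑ ^ p := by
        gcongr
        exact lintegral_le_tsum_cube hm0
    _ ≤ C * ∑' i : Fin N → ℤ, ∫⁻ x in cube N 1, ‖fderiv ℝ v (x + latticePoint i)‖ₑ ^ p := by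
        rw [← ENNReal.tsum_mul_left, ← ENNReal.tsum_mul_left]
        refine ENNReal.tsum_le_tsum fun i => ?_
        have := h K hK (fun x => v (x + latticePoint i)) (by fun_prop) fun x hx => by
          rw [add_comm]; exact hvK i x hx
        simpa only [fderiv_comp_add_right] using this
    _ ≤ C * (2 ^ N * ∫⁻ x, ‖fderiv ℝ v x‖ₑ ^ p) := by
        gcongr
        exact tsum_cube_le hm1
    _ = _ := by ring

end Lattice

/-! ### Linear changes of variables -/

section Dilation

/-- The diagonal map `D_t` as a linear automorphism. -/
noncomputable def dilationEquiv (t : Fin N → ℝ) (ht : ∀ j, 0 < t j) :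
    EuclideanSpace ℝ (Fin N) ≃L[ℝ] EuclideanSpace ℝ (Fin N) :=
  LinearEquiv.toContinuousLinearEquiv
    { toFun := dilation t
      invFun := dilation fun j => (t j)⁻¹
      map_add' := fun x y => by ext j; simp [dilation, mul_add]
      map_smul' := fun a x => by ext j; simp [dilation]; ring
      left_inv := fun x => by ext j; simp [dilation, (ht j).ne']
      right_inv := fun x => by ext j; simp [dilation, (ht j).ne'] }

theorem norm_dilationEquiv_le (t : Fin N → ℝ) (ht : ∀ j, 0 < t j) :
    ‖(dilationEquiv t ht : EuclideanSpace ℝ (Fin N) →L[ℝ] EuclideanSpace ℝ (Fin N))‖ ≤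
      ⨆ j, t j := by
  have hT : 0 ≤ ⨆ j, t j := Real.iSup_nonneg fun j => (ht j).le
  refine ContinuousLinearMap.opNorm_le_bound _ hT fun x => ?_
  change ‖dilation t x‖ ≤ _
  refine le_of_sq_le_sq ?_ (by positivity)
  rw [mul_pow, EuclideanSpace.norm_sq_eq, EuclideanSpace.norm_sq_eq, Finset.mul_sum]
  refine Finset.sum_le_sum fun j _ => ?_
  simp only [dilation, norm_mul, mul_pow]
  gcongr
  rw [Real.norm_of_nonneg (ht j).le]
  exact le_ciSup (Set.finite_range t).bddAbove j

variable {E : Type*} [NormedAddCommGroup E] [NormedSpace ℝ E]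

theorem enorm_fderiv_comp_equiv_le {φ : E → ℝ} (hφ : Differentiable ℝ φ) (e : E ≃L[ℝ] E) (x : E) :
    ‖fderiv ℝ (fun y => φ (e y)) x‖ₑ ≤ ‖(e : E →L[ℝ] E)‖ₑ * ‖fderiv ℝ φ (e x)‖ₑ := by
  have h : fderiv ℝ (fun y => φ (e y)) x = (fderiv ℝ φ (e x)).comp (e : E →L[ℝ] E) :=
    ((hφ (e x)).hasFDerivAt.comp x e.hasFDerivAt).fderiv
  rw [h, mul_comm]
  simp only [← ofReal_norm]
  rw [← ENNReal.ofReal_mul (norm_nonneg _)]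
  exact ENNReal.ofReal_le_ofReal (ContinuousLinearMap.opNorm_comp_le _ _)

theorem lintegral_enorm_fderiv_comp_equiv_le [MeasurableSpace E] [BorelSpace E] (μ : Measure E)
    {φ : E → ℝ} (hφ : ContDiff ℝ 1 φ) (e : E ≃L[ℝ] E)
    {p : ℝ} (hp : 0 ≤ p) :
    ∫⁻ x, ‖fderiv ℝ (fun y => φ (e y)) x‖ₑ ^ p ∂μ ≤
      ‖(e : E →L[ℝ] E)‖ₑ ^ p * ∫⁻ x, ‖fderiv ℝ φ (e x)‖ₑ ^ p ∂μ := by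
  have hm : Measurable fun x => ‖fderiv ℝ φ (e x)‖ₑ ^ p :=
    (((hφ.continuous_fderiv one_ne_zero).comp e.continuous).enorm.measurable).pow_const p
  rw [← lintegral_const_mul _ hm]
  refine lintegral_mono fun x => ?_
  rw [← ENNReal.mul_rpow_of_nonneg _ _ hp]
  exact ENNReal.rpow_le_rpow
    (enorm_fderiv_comp_equiv_le (hφ.differentiable one_ne_zero) e x) hp

variable [FiniteDimensional ℝ E] [MeasurableSpace E] [BorelSpace E] (μ : Measure E)
  [μ.IsAddHaarMeasure]

/-- The Jacobian stays anonymous: it will appear on both sides of an inequality, and cancelling it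
requires only that it be nonzero and finite. -/
theorem exists_lintegral_comp_equiv (e : E ≃L[ℝ] E) :
    ∃ k : ℝ≥0∞, k ≠ 0 ∧ k ≠ ⊤ ∧ ∀ f : E → ℝ≥0∞, ∫⁻ x, f (e x) ∂μ = k * ∫⁻ x, f x ∂μ := by
  have hdet : LinearMap.det (e : E →ₗ[ℝ] E) ≠ 0 := (LinearEquiv.isUnit_det' e.toLinearEquiv).ne_zero
  refine ⟨ENNReal.ofReal |(LinearMap.det (e : E →ₗ[ℝ] E))⁻¹|, by simpa using hdet,
    ENNReal.ofReal_ne_top, fun f => ?_⟩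
  have h := e.toHomeomorph.measurableEmbedding.lintegral_map (μ := μ) f
  have h2 := Measure.map_linearMap_addHaar_eq_smul_addHaar μ hdet
  have e2 : (⇑e.toHomeomorph) = ⇑(e : E →ₗ[ℝ] E) := rfl
  rw [e2, h2, lintegral_smul_measure] at h
  exact h.symm

end Dilation

/-! ### The lower bound for the Poincaré constant -/

section LowerBound

variable {p : ℝ} {U : Set (EuclideanSpace ℝ (Fin N))} {φ : EuclideanSpace ℝ (Fin N) → ℝ}

theorem eLpNorm_testFunction (hp : 0 < p) (hφ : φ ∈ testFunctions U) :
    eLpNorm φ (ENNReal.ofReal p) (volume.restrict U) = (∫⁻ x, ‖φ x‖ₑ ^ p) ^ (1 / p) := by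
  rw [eLpNorm_restrict_eq_of_support_subset ((subset_tsupport φ).trans hφ.2.2),
    eLpNorm_eq_lintegral_rpow_enorm_toReal (by simpa using hp) ENNReal.ofReal_ne_top,
    ENNReal.toReal_ofReal hp.le]

theorem eLpNorm_testFunction_eq_one_iff (hp : 0 < p) (hφ : φ ∈ testFunctions U) :
    eLpNorm φ (ENNReal.ofReal p) (volume.restrict U) = 1 ↔ ∫⁻ x, ‖φ x‖ₑ ^ p = 1 := by
  rw [eLpNorm_testFunction hp hφ]
  constructor
  · intro h
    simpa [← ENNReal.rpow_mul, hp.ne'] using congrArg (· ^ p) h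
  · intro h; simp [h]

/-- The lower bound, as an inequality for each test function. -/
theorem exists_relCapacity_mul_lintegral_le_of_perforated (N : ℕ) {p : ℝ} (hp : 1 ≤ p) :
    ∃ C : ℝ≥0∞, C ≠ ⊤ ∧ ∀ (t : Fin N → ℝ) (K Ω : Set (EuclideanSpace ℝ (Fin N))),
      IsPeriodicallyPerforated t K Ω → ∀ φ ∈ testFunctions Ω,
      relCapacity p K (cube N 1) * ∫⁻ x, ‖φ x‖ₑ ^ p ≤
        C * ENNReal.ofReal (⨆ j, t j) ^ p * dirichletIntegral p Ω φ := by
  have hp0 : 0 < p := by linarith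
  obtain ⟨C, hC, h⟩ := exists_relCapacity_mul_lintegral_le_of_periodic N hp
  refine ⟨C, hC, fun t K Ω hΩ φ hφ => ?_⟩
  rw [dirichletIntegral_eq_lintegral hp0 hφ]
  set e := dilationEquiv t hΩ.pos with he
  obtain ⟨k, hk0, hkt, hk⟩ := exists_lintegral_comp_equiv volume e
  have hv : ∀ i, ∀ x ∈ K, φ (e (latticePoint i + x)) = 0 := fun i x hx => by
    refine image_eq_zero_of_notMem_tsupport fun hmem => ?_
    have := hφ.2.2 hmem
    rw [hΩ.eq_perforatedSet, perforatedSet, Set.mem_compl_iff, Set.mem_iUnion] at this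
    exact this ⟨i, _, ⟨x, hx, rfl⟩, rfl⟩
  have hT : ‖(e : EuclideanSpace ℝ (Fin N) →L[ℝ] EuclideanSpace ℝ (Fin N))‖ₑ ≤
      ENNReal.ofReal (⨆ j, t j) := by
    rw [← ofReal_norm]
    exact ENNReal.ofReal_le_ofReal (norm_dilationEquiv_le t hΩ.pos)
  have key := h K hΩ.ssubset.subset (fun y => φ (e y)) (hφ.1.comp e.contDiff) hv
  rw [hk fun x => ‖φ x‖ₑ ^ p] at key
  have hD : ∫⁻ x, ‖fderiv ℝ (fun y => φ (e y)) x‖ₑ ^ p ≤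
      ENNReal.ofReal (⨆ j, t j) ^ p * (k * ∫⁻ x, ‖fderiv ℝ φ x‖ₑ ^ p) := by
    rw [← hk fun x => ‖fderiv ℝ φ x‖ₑ ^ p]
    exact (lintegral_enorm_fderiv_comp_equiv_le volume (hφ.1.of_le (by simp)) e hp0.le).trans
      (by gcongr)
  refine (ENNReal.mul_le_mul_iff_right hk0 hkt).1 ?_
  calc _ = relCapacity p K (cube N 1) * (k * ∫⁻ x, ‖φ x‖ₑ ^ p) := by ring
    _ ≤ C * (ENNReal.ofReal (⨆ j, t j) ^ p * (k * ∫⁻ x, ‖fderiv ℝ φ x‖ₑ ^ p)) :=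
        key.trans (mul_le_mul' le_rfl hD)
    _ = _ := by ring

theorem exists_ofReal_mul_relCapacity_le_poincareConst {N : ℕ} (hN : 0 < N) {p : ℝ}
    (hp : 1 ≤ p) :
    ∃ c : ℝ, 0 < c ∧ ∀ (t : Fin N → ℝ) (K Ω : Set (EuclideanSpace ℝ (Fin N))),
      IsPeriodicallyPerforated t K Ω → 0 < ⨆ j, t j ∧
      ENNReal.ofReal (c * (1 / (⨆ j, t j)) ^ p) * relCapacity p K (cube N 1) ≤
        poincareConst p Ω := by
  have hp0 : 0 < p := by linarith
  obtain ⟨C, hC, h⟩ := exists_relCapacity_mul_lintegral_le_of_perforated N hp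
  -- Adding `1` keeps the denominator positive even when `C` is zero.
  refine ⟨1 / (C.toReal + 1), by positivity, fun t K Ω hΩ => ?_⟩
  have hT : 0 < ⨆ j, t j := (hΩ.pos ⟨0, hN⟩).trans_le
    (le_ciSup (Set.finite_range t).bddAbove _)
  refine ⟨hT, le_iInf₂ fun φ hφ => ?_⟩
  have key := h t K Ω hΩ φ hφ.1
  rw [(eLpNorm_testFunction_eq_one_iff hp0 hφ.1).1 hφ.2, mul_one] at key
  refine (mul_le_mul' le_rfl key).trans ?_
  rw [← mul_assoc]
  refine mul_le_of_le_one_left' ?_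
  rw [ENNReal.ofReal_rpow_of_pos hT]
  nth_rw 2 [← ENNReal.ofReal_toReal hC]
  rw [← ENNReal.ofReal_mul (by positivity), ← ENNReal.ofReal_mul (by positivity)]
  refine ENNReal.ofReal_le_one.2 ?_
  rw [Real.div_rpow zero_le_one hT.le, Real.one_rpow]
  have : 0 < (⨆ j, t j) ^ p := by positivity
  have e : 1 / (C.toReal + 1) * (1 / (⨆ j, t j) ^ p) * (C.toReal * (⨆ j, t j) ^ p) =
      C.toReal / (C.toReal + 1) := by
    field_simp
  rw [e, div_le_one (by positivity)]
  linarith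

end LowerBound

/-! ### Smooth truncation of capacity competitors -/

section Truncation

theorem rpow_finset_sum_le {ι : Type*} (s : Finset ι) (f : ι → ℝ≥0∞) {p : ℝ} (hp : 0 < p) :
    (∑ i ∈ s, f i) ^ p ≤ (s.card : ℝ≥0∞) ^ p * ∑ i ∈ s, f i ^ p := by
  have h : ∑ i ∈ s, f i ≤ s.card * (∑ i ∈ s, f i ^ p) ^ (1 / p) := by
    rw [← nsmul_eq_mul]
    refine Finset.sum_le_card_nsmul _ _ _ fun i hi => ?_
    rw [one_div, ENNReal.le_rpow_inv_iff hp]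
    exact Finset.single_le_sum (f := fun i => f i ^ p) (fun _ _ => zero_le) hi
  refine (ENNReal.rpow_le_rpow h hp.le).trans_eq ?_
  rw [ENNReal.mul_rpow_of_nonneg _ _ hp.le, ← ENNReal.rpow_mul, one_div,
    inv_mul_cancel₀ hp.ne', ENNReal.rpow_one]

/-- A smooth step with values in `[0, 1]`, equal to `0` on `(-∞, 0]` and to `1` on `[1/2, ∞)`. -/
noncomputable def smoothStep (s : ℝ) : ℝ := Real.smoothTransition (2 * s)

theorem contDiff_smoothStep : ContDiff ℝ ∞ smoothStep :=
  Real.smoothTransition.contDiff.comp (contDiff_const.mul contDiff_id)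

theorem smoothStep_eq_one {s : ℝ} (h : 1 / 2 ≤ s) : smoothStep s = 1 :=
  Real.smoothTransition.one_of_one_le (by linarith)

theorem smoothStep_eq_zero {s : ℝ} (h : s ≤ 0) : smoothStep s = 0 :=
  Real.smoothTransition.zero_of_nonpos (by linarith)

theorem smoothStep_mem_Icc (s : ℝ) : smoothStep s ∈ Set.Icc (0 : ℝ) 1 :=
  ⟨Real.smoothTransition.nonneg _, Real.smoothTransition.le_one _⟩

/-- The derivative vanishes outside `[0, 1]`, so compactness bounds it; the linear bound follows
from the mean value inequality, since the step vanishes at `0`. -/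
theorem exists_smoothStep_bound : ∃ L : ℝ≥0∞, L ≠ ⊤ ∧ (∀ s, ‖deriv smoothStep s‖ₑ ≤ L) ∧
    ∀ s, ‖smoothStep s‖ₑ ≤ L * ‖s‖ₑ := by
  obtain ⟨M, hM⟩ := (isCompact_Icc (a := (0 : ℝ)) (b := 1)).exists_bound_of_continuousOn
    (contDiff_smoothStep.continuous_deriv (by simp)).continuousOn
  have hM0 : 0 ≤ M := (norm_nonneg _).trans (hM 0 ⟨le_rfl, zero_le_one⟩)
  have hb : ∀ s, ‖deriv smoothStep s‖ ≤ M := fun s => by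
    rcases lt_or_ge s 0 with h | h
    · have : smoothStep =ᶠ[nhds s] fun _ => 0 := by
        filter_upwards [eventually_lt_nhds h] with x hx using smoothStep_eq_zero hx.le
      simp [this.deriv_eq, hM0]
    rcases le_or_gt s 1 with h1 | h1
    · exact hM s ⟨h, h1⟩
    · have : smoothStep =ᶠ[nhds s] fun _ => 1 := by
        filter_upwards [eventually_gt_nhds h1] with x hx using smoothStep_eq_one (by linarith)
      simp [this.deriv_eq, hM0]
  refine ⟨ENNReal.ofReal M, ENNReal.ofReal_ne_top, fun s => ?_, fun s => ?_⟩
  · rw [← ofReal_norm]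
    exact ENNReal.ofReal_le_ofReal (hb s)
  · have := convex_univ.norm_image_sub_le_of_norm_deriv_le (f := smoothStep) (C := M)
      (fun x _ => contDiff_smoothStep.differentiable (by simp) x) (fun x _ => hb x)
      (Set.mem_univ 0) (Set.mem_univ s)
    rw [smoothStep_eq_zero le_rfl, sub_zero, sub_zero] at this
    rw [← ofReal_norm, ← ofReal_norm, ← ENNReal.ofReal_mul hM0]
    exact ENNReal.ofReal_le_ofReal this

theorem enorm_fderiv_smoothStep_comp_le {L : ℝ≥0∞} (hL : ∀ s, ‖deriv smoothStep s‖ₑ ≤ L)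
    {u : EuclideanSpace ℝ (Fin N) → ℝ} (hu : Differentiable ℝ u) (x : EuclideanSpace ℝ (Fin N)) :
    ‖fderiv ℝ (fun y => smoothStep (u y)) x‖ₑ ≤ L * ‖fderiv ℝ u x‖ₑ := by
  have h : fderiv ℝ (fun y => smoothStep (u y)) x = deriv smoothStep (u x) • fderiv ℝ u x :=
    ((contDiff_smoothStep.differentiable (by simp) (u x)).hasDerivAt.comp_hasFDerivAt x
      (hu x).hasFDerivAt).fderiv
  rw [h, enorm_smul]
  gcongr
  exact hL _

/-- From a function competing for the capacity of `K`, a function with values in `[0, 1]` that is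
equal to `1` near finitely many translates of `K`. -/
theorem exists_eq_one_near_translates (hN : 0 < N) {p : ℝ} (hp : 1 ≤ p) :
    ∃ A : ℝ≥0∞, A ≠ ⊤ ∧ ∀ (K : Set (EuclideanSpace ℝ (Fin N)))
      (I : Finset (Fin N → ℤ)), ∀ u ∈ testFunctions (cube N 1), (∀ x ∈ K, 1 ≤ u x) →
      ∃ w : EuclideanSpace ℝ (Fin N) → ℝ, ContDiff ℝ ∞ w ∧ (∀ x, w x ∈ Set.Icc (0 : ℝ) 1) ∧
        (∀ i ∈ I, ∀ x ∈ K, ∀ᶠ y in nhds (latticePoint i + x), w y = 1) ∧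
        ∫⁻ x, ‖fderiv ℝ w x‖ₑ ^ p ≤
          A * (I.card : ℝ≥0∞) ^ p * I.card * dirichletIntegral p (cube N 1) u ∧
        ∫⁻ x, ‖w x‖ₑ ^ p ≤
          A * (I.card : ℝ≥0∞) ^ p * I.card * dirichletIntegral p (cube N 1) u := by
  have hp0 : 0 < p := by linarith
  obtain ⟨L, hLt, hL1, hL0⟩ := exists_smoothStep_bound
  obtain ⟨C, hC, hFr⟩ := exists_lintegral_le_dirichletIntegral hN hp
  -- Each of two nested smooth steps costs a factor `L`. The summand `1` serves the gradient bound,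
  -- and the Friedrichs constant `C` the bound on `w`.
  refine ⟨(L * L) ^ p * (1 + C), ENNReal.mul_ne_top (ENNReal.rpow_ne_top_of_nonneg hp0.le
    (ENNReal.mul_ne_top hLt hLt)) (by finiteness), fun K I u hu huK => ?_⟩
  set δ := dirichletIntegral p (cube N 1) u with hδ
  have hFr' := hFr u hu
  rw [← dirichletIntegral_eq_lintegral hp0 hu, ← hδ] at hFr'
  have hud : Differentiable ℝ u := hu.1.differentiable (by simp)
  set g : EuclideanSpace ℝ (Fin N) → ℝ := fun x => smoothStep (u x) with hg
  have hgs : ContDiff ℝ ∞ g := contDiff_smoothStep.comp hu.1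
  have hgd : Differentiable ℝ g := hgs.differentiable (by simp)
  set S : EuclideanSpace ℝ (Fin N) → ℝ := fun x => ∑ i ∈ I, g (x - latticePoint i) with hS
  have hSs : ContDiff ℝ ∞ S := ContDiff.sum fun i _ => hgs.comp (contDiff_id.sub contDiff_const)
  have hSd : Differentiable ℝ S := hSs.differentiable (by simp)
  have hsum : ∀ (F : EuclideanSpace ℝ (Fin N) → ℝ≥0∞), Measurable F →
      ∫⁻ x, (L * L * ∑ i ∈ I, F (x - latticePoint i)) ^ p ≤
        (L * L) ^ p * ((I.card : ℝ≥0∞) ^ p * (I.card * ∫⁻ x, F x ^ p)) := by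
    intro F hF
    calc _ ≤ ∫⁻ x, (L * L) ^ p * ((I.card : ℝ≥0∞) ^ p * ∑ i ∈ I, F (x - latticePoint i) ^ p) := by
          refine lintegral_mono fun x => ?_
          rw [ENNReal.mul_rpow_of_nonneg _ _ hp0.le]
          gcongr
          exact rpow_finset_sum_le _ _ hp0
      _ = _ := by
          rw [lintegral_const_mul _ (by fun_prop), lintegral_const_mul _ (by fun_prop),
            lintegral_finsetSum _ (by fun_prop)]
          simp_rw [lintegral_sub_right_eq_self (fun x => F x ^ p)]
          simp
  -- The inner step makes every summand nonnegative, so one summand equal to `1` forces `S ≥ 1`; the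
  -- outer step caps the sum at `1`. Saturation already at `1 / 2` gives equality on a neighbourhood
  -- of each translate of `K`.
  refine ⟨fun x => smoothStep (S x), contDiff_smoothStep.comp hSs,
    fun x => smoothStep_mem_Icc _, ?_, ?_, ?_⟩
  · intro i hi x hx
    have hc : Continuous fun y => u (y - latticePoint i) :=
      hu.1.continuous.comp (by fun_prop)
    have hlt : (1 / 2 : ℝ) < u (latticePoint i + x - latticePoint i) := by
      rw [add_sub_cancel_left]
      linarith [huK x hx]
    filter_upwards [hc.continuousAt.eventually (eventually_gt_nhds hlt)] with y hy
    refine smoothStep_eq_one ?_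
    have h1 : g (y - latticePoint i) = 1 := smoothStep_eq_one hy.le
    have h2 : g (y - latticePoint i) ≤ S y := Finset.single_le_sum
      (f := fun i => g (y - latticePoint i)) (fun _ _ => (smoothStep_mem_Icc _).1) hi
    linarith
  · have hpt : ∀ x, ‖fderiv ℝ (fun x => smoothStep (S x)) x‖ₑ ≤
        L * L * ∑ i ∈ I, ‖fderiv ℝ u (x - latticePoint i)‖ₑ := fun x => by
      refine (enorm_fderiv_smoothStep_comp_le hL1 hSd x).trans ?_
      rw [mul_assoc]
      gcongr
      have hf : fderiv ℝ S x = ∑ i ∈ I, fderiv ℝ g (x - latticePoint i) := by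
        rw [hS, fderiv_fun_sum]
        · simp_rw [sub_eq_add_neg, fderiv_comp_add_right]
        · intro i _
          exact (hgd _).comp x (by fun_prop)
      rw [hf, Finset.mul_sum]
      refine (enorm_sum_le I fun i => fderiv ℝ g (x - latticePoint i)).trans
        (Finset.sum_le_sum fun i _ => ?_)
      exact enorm_fderiv_smoothStep_comp_le hL1 hud _
    refine (lintegral_mono fun x => ENNReal.rpow_le_rpow (hpt x) hp0.le).trans
      ((hsum _ (hu.1.continuous_fderiv (by simp)).enorm.measurable).trans ?_)
    rw [← dirichletIntegral_eq_lintegral hp0 hu, ← hδ]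
    calc _ = (L * L) ^ p * 1 * (I.card : ℝ≥0∞) ^ p * I.card * δ := by ring
      _ ≤ _ := by gcongr; exact le_self_add
  · have hpt : ∀ x, ‖smoothStep (S x)‖ₑ ≤
        L * L * ∑ i ∈ I, ‖u (x - latticePoint i)‖ₑ := fun x => by
      refine (hL0 _).trans ?_
      rw [mul_assoc]
      gcongr
      rw [Finset.mul_sum]
      refine (enorm_sum_le I fun i => g (x - latticePoint i)).trans
        (Finset.sum_le_sum fun i _ => hL0 _)
    refine (lintegral_mono fun x => ENNReal.rpow_le_rpow (hpt x) hp0.le).trans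
      ((hsum _ hu.1.continuous.enorm.measurable).trans ?_)
    calc _ ≤ (L * L) ^ p * ((I.card : ℝ≥0∞) ^ p * (I.card * (C * δ))) := by gcongr
      _ = (L * L) ^ p * C * (I.card : ℝ≥0∞) ^ p * I.card * δ := by ring
      _ ≤ _ := by gcongr; exact le_add_self

end Truncation

/-! ### The Poincaré inequality without normalisation and in undilated coordinates -/

section Vanishing

variable {p : ℝ} {U : Set (EuclideanSpace ℝ (Fin N))} {φ : EuclideanSpace ℝ (Fin N) → ℝ}

theorem const_mul_mem_testFunctions (hφ : φ ∈ testFunctions U) (s : ℝ) :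
    (fun x => s * φ x) ∈ testFunctions U := by
  have hts : tsupport (fun x => s * φ x) ⊆ tsupport φ :=
    closure_mono fun x hx h => hx (by simp [h])
  exact ⟨contDiff_const.mul hφ.1, hφ.2.1.of_isClosed_subset (isClosed_tsupport _) hts,
    hts.trans hφ.2.2⟩

/-- Both integrals are homogeneous of degree `p`, so dividing `φ` by its `L^p` norm reduces to the
normalised case. -/
theorem poincareConst_mul_lintegral_le (hp : 0 < p) (hφ : φ ∈ testFunctions U) :
    poincareConst p U * ∫⁻ x, ‖φ x‖ₑ ^ p ≤ ∫⁻ x, ‖fderiv ℝ φ x‖ₑ ^ p := by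
  set a := ∫⁻ x, ‖φ x‖ₑ ^ p with ha
  have hat : a ≠ ⊤ := (lintegral_enorm_rpow_lt_top hφ.1.continuous hφ.2.1 hp).ne
  rcases eq_or_ne a 0 with h0 | h0
  · simp [h0]
  have hφd : Differentiable ℝ φ := hφ.1.differentiable (by simp)
  have har : 0 < a.toReal := ENNReal.toReal_pos h0 hat
  set s : ℝ := a.toReal ^ (-(1 / p)) with hs
  have hs0 : 0 < s := by positivity
  have hsp : ‖s‖ₑ ^ p = a⁻¹ := by
    rw [Real.enorm_eq_ofReal hs0.le, ENNReal.ofReal_rpow_of_pos hs0, hs, ← Real.rpow_mul har.le,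
      neg_mul, one_div, inv_mul_cancel₀ hp.ne', Real.rpow_neg_one, ENNReal.ofReal_inv_of_pos har,
      ENNReal.ofReal_toReal hat]
  have hψ := const_mul_mem_testFunctions hφ s
  have h1 : ∫⁻ x, ‖s * φ x‖ₑ ^ p = 1 := by
    have : ∀ x, ‖s * φ x‖ₑ ^ p = a⁻¹ * ‖φ x‖ₑ ^ p := fun x => by
      rw [enorm_mul, ENNReal.mul_rpow_of_nonneg _ _ hp.le, hsp]
    simp_rw [this]
    rw [lintegral_const_mul _ ((hφ.1.continuous.enorm.measurable).pow_const p), ← ha,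
      ENNReal.inv_mul_cancel h0 hat]
  have hle : poincareConst p U ≤ dirichletIntegral p U _ :=
    iInf₂_le (fun x => s * φ x) ⟨hψ, (eLpNorm_testFunction_eq_one_iff hp hψ).2 h1⟩
  have h2 : ∫⁻ x, ‖fderiv ℝ (fun x => s * φ x) x‖ₑ ^ p = a⁻¹ * ∫⁻ x, ‖fderiv ℝ φ x‖ₑ ^ p := by
    rw [← lintegral_const_mul _ (((hφ.1.continuous_fderiv (by simp)).enorm.measurable).pow_const p)]
    refine lintegral_congr fun x => ?_
    rw [fderiv_const_mul (hφd x), enorm_smul, ENNReal.mul_rpow_of_nonneg _ _ hp.le, hsp]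
  rw [dirichletIntegral_eq_lintegral hp hψ, h2] at hle
  calc _ ≤ a⁻¹ * (∫⁻ x, ‖fderiv ℝ φ x‖ₑ ^ p) * a := by gcongr
    _ = (a⁻¹ * a) * ∫⁻ x, ‖fderiv ℝ φ x‖ₑ ^ p := by ring
    _ = _ := by rw [ENNReal.inv_mul_cancel h0 hat, one_mul]

/-- Composition with the inverse of `D_t` turns `v`, which avoids the undilated holes, into a test
function on `Ω`. The constant does not depend on `v`. -/
theorem exists_poincareConst_mul_lintegral_le_of_perforated (hp : 0 < p) {t : Fin N → ℝ}
    {K Ω : Set (EuclideanSpace ℝ (Fin N))} (hΩ : IsPeriodicallyPerforated t K Ω) :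
    ∃ D : ℝ≥0∞, D ≠ ⊤ ∧ ∀ v : EuclideanSpace ℝ (Fin N) → ℝ, ContDiff ℝ ∞ v →
      HasCompactSupport v → (∀ i, ∀ x ∈ K, latticePoint i + x ∉ tsupport v) →
      poincareConst p Ω * ∫⁻ x, ‖v x‖ₑ ^ p ≤ D * ∫⁻ x, ‖fderiv ℝ v x‖ₑ ^ p := by
  set e := dilationEquiv t hΩ.pos with he
  obtain ⟨k, hk0, hkt, hk⟩ := exists_lintegral_comp_equiv volume e.symm
  refine ⟨‖(e.symm : EuclideanSpace ℝ (Fin N) →L[ℝ] EuclideanSpace ℝ (Fin N))‖ₑ ^ p,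
    ENNReal.rpow_ne_top_of_nonneg hp.le enorm_ne_top, fun v hv hvc hvK => ?_⟩
  have hts : tsupport (fun x => v (e.symm x)) = e.symm ⁻¹' tsupport v :=
    tsupport_comp_eq_preimage v e.symm.toHomeomorph
  have hmem : (fun x => v (e.symm x)) ∈ testFunctions Ω := by
    refine ⟨hv.comp e.symm.contDiff, hvc.comp_homeomorph e.symm.toHomeomorph, ?_⟩
    rw [hts, hΩ.eq_perforatedSet]
    intro y hy hy'
    obtain ⟨i, _, ⟨x, hx, rfl⟩, rfl⟩ := Set.mem_iUnion.1 hy'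
    refine hvK i x hx ?_
    have : e.symm (dilation t (latticePoint i + x)) = latticePoint i + x :=
      e.symm_apply_apply _
    rw [← this]
    exact hy
  have key := poincareConst_mul_lintegral_le hp hmem
  rw [hk fun x => ‖v x‖ₑ ^ p] at key
  have h2 := lintegral_enorm_fderiv_comp_equiv_le volume (hv.of_le (by simp)) e.symm hp.le
  rw [hk fun x => ‖fderiv ℝ v x‖ₑ ^ p] at h2
  refine (ENNReal.mul_le_mul_iff_right hk0 hkt).1 ?_
  calc _ = poincareConst p Ω * (k * ∫⁻ x, ‖v x‖ₑ ^ p) := by ring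
    _ ≤ _ := key.trans h2
    _ = _ := by ring

end Vanishing

/-! ### Zero capacity forces a zero Poincaré constant -/

variable {p : ℝ} {t : Fin N → ℝ} {K Ω : Set (EuclideanSpace ℝ (Fin N))}

theorem exists_finset_translates_inter {T : Set (EuclideanSpace ℝ (Fin N))}
    (hT : Bornology.IsBounded T) :
    ∃ I : Finset (Fin N → ℤ), ∀ i, ∀ x ∈ closure (cube N (1 / 2)),
      latticePoint i + x ∈ T → i ∈ I := by
  obtain ⟨r, hr⟩ := hT.exists_norm_le
  refine ⟨Fintype.piFinset fun _ => Finset.Icc (-⌈r + 1⌉) ⌈r + 1⌉, fun i x hx hi => ?_⟩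
  rw [Fintype.mem_piFinset]
  intro j
  have h1 : |(i j : ℝ) + x j| ≤ r := by
    have := (PiLp.norm_apply_le (latticePoint i + x) j).trans (hr _ hi)
    simpa [latticePoint] using this
  have h2 := closure_cube_subset _ hx j
  have h3 := Int.le_ceil (r + 1)
  rw [abs_le] at h1
  rw [Set.mem_Icc] at h2
  rw [Finset.mem_Icc]
  constructor
  · have : ((-⌈r + 1⌉ : ℤ) : ℝ) ≤ i j := by push_cast; linarith
    exact_mod_cast this
  · have : (i j : ℝ) ≤ (⌈r + 1⌉ : ℤ) := by linarith
    exact_mod_cast this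

theorem exists_relCapacity_competitor (h0 : relCapacity p K (cube N 1) = 0) {ε : ℝ≥0∞}
    (hε : 0 < ε) : ∃ u ∈ testFunctions (cube N 1), (∀ x ∈ K, 1 ≤ u x) ∧
      dirichletIntegral p (cube N 1) u < ε := by
  rw [← h0, relCapacity, iInf_lt_iff] at hε
  obtain ⟨u, hu⟩ := hε
  obtain ⟨hu1, hu2⟩ := iInf_lt_iff.1 hu
  exact ⟨u, hu1.1, hu1.2, hu2⟩

/-- If the holes have zero capacity, the Poincaré inequality of `Ω` holds for all functions. -/
theorem exists_poincareConst_mul_lintegral_le_of_relCapacity_eq_zero (hN : 0 < N) (hp : 1 ≤ p)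
    (hΩ : IsPeriodicallyPerforated t K Ω) (h0 : relCapacity p K (cube N 1) = 0) :
    ∃ B : ℝ≥0∞, B ≠ ⊤ ∧ ∀ χ : EuclideanSpace ℝ (Fin N) → ℝ, ContDiff ℝ ∞ χ →
      HasCompactSupport χ → (∀ x, χ x ∈ Set.Icc (0 : ℝ) 1) →
      min (poincareConst p Ω) 1 * ∫⁻ x, ‖χ x‖ₑ ^ p ≤ B * ∫⁻ x, ‖fderiv ℝ χ x‖ₑ ^ p := by
  have hp0 : 0 < p := by linarith
  have h2t : (2 : ℝ≥0∞) ^ (p - 1) ≠ ⊤ :=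
    ENNReal.rpow_ne_top_of_nonneg (by linarith) (by simp)
  obtain ⟨D, hD, hDv⟩ := exists_poincareConst_mul_lintegral_le_of_perforated hp0 hΩ
  obtain ⟨A, hA, hAw⟩ := exists_eq_one_near_translates hN hp
  -- No dependence on the number of holes met by `χ`: that number enters only through `A'`, which
  -- multiplies the vanishing energy of `u`.
  refine ⟨2 ^ (p - 1) * (D * 2 ^ (p - 1)), by finiteness, fun χ hχ hχc hχr => ?_⟩
  obtain ⟨I, hI⟩ := exists_finset_translates_inter hχc.isCompact.isBounded
  set A' : ℝ≥0∞ := A * (I.card : ℝ≥0∞) ^ p * I.card with hA'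
  have hA't : A' ≠ ⊤ := ENNReal.mul_ne_top (ENNReal.mul_ne_top hA
    (ENNReal.rpow_ne_top_of_nonneg hp0.le (by simp))) (by simp)
  -- Capping at `1` gives `ℓ * (A' * δ) ≤ A' * δ` without knowing that the Poincaré constant is
  -- finite.
  set ℓ := min (poincareConst p Ω) 1 with hℓ
  set G := ∫⁻ x, ‖fderiv ℝ χ x‖ₑ ^ p with hG
  set b : ℝ≥0∞ := 2 ^ (p - 1) * (D * 2 ^ (p - 1) * A' + A') with hb
  have hbt : b ≠ ⊤ := by finiteness
  have hGm : Measurable fun x => ‖fderiv ℝ χ x‖ₑ ^ p :=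
    ((hχ.continuous_fderiv (by simp)).enorm.measurable).pow_const p
  have main : ∀ u ∈ testFunctions (cube N 1), (∀ x ∈ K, 1 ≤ u x) →
      ℓ * ∫⁻ x, ‖χ x‖ₑ ^ p ≤
        2 ^ (p - 1) * (D * 2 ^ (p - 1)) * G + b * dirichletIntegral p (cube N 1) u := by
    intro u hu huK
    obtain ⟨w, hws, hwr, hw1, hwD, hw0⟩ := hAw K I u hu huK
    set δ := dirichletIntegral p (cube N 1) u
    have hχd : Differentiable ℝ χ := hχ.differentiable (by simp)
    have hwd : Differentiable ℝ w := hws.differentiable (by simp)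
    have hvs : ContDiff ℝ ∞ fun x => χ x * (1 - w x) := hχ.mul (contDiff_const.sub hws)
    have hts : tsupport (fun x => χ x * (1 - w x)) ⊆ tsupport χ :=
      closure_mono fun x hx h => hx (by simp [h])
    have hv := hDv (fun x => χ x * (1 - w x)) hvs
      (hχc.of_isClosed_subset (isClosed_tsupport _) hts) fun i x hx hmem => by
        have hi := hI i x (hΩ.ssubset.subset hx) (hts hmem)
        refine notMem_tsupport_iff_eventuallyEq.2 ?_ hmem
        filter_upwards [hw1 i hi x hx] with y hy
        simp [hy]
    have henorm : ∀ {a : ℝ}, a ∈ Set.Icc (0 : ℝ) 1 → ‖a‖ₑ ≤ 1 := fun {a} ha => by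
      rw [Real.enorm_eq_ofReal ha.1]
      exact ENNReal.ofReal_le_one.2 ha.2
    have hgrad : ∫⁻ x, ‖fderiv ℝ (fun x => χ x * (1 - w x)) x‖ₑ ^ p ≤
        2 ^ (p - 1) * (G + A' * δ) := by
      refine le_trans ?_ (mul_le_mul' le_rfl (add_le_add le_rfl hwD))
      rw [hG, ← lintegral_add_left hGm, ← lintegral_const_mul' _ _ h2t]
      refine lintegral_mono fun x => le_trans ?_ (ENNReal.rpow_add_le_mul_rpow_add_rpow _ _ hp)
      refine ENNReal.rpow_le_rpow ?_ hp0.le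
      have hder : fderiv ℝ (fun x => χ x * (1 - w x)) x =
          χ x • (-fderiv ℝ w x) + (1 - w x) • fderiv ℝ χ x :=
        ((hχd x).hasFDerivAt.mul ((hwd x).hasFDerivAt.const_sub 1)).fderiv
      rw [hder]
      refine (enorm_add_le (χ x • (-fderiv ℝ w x)) ((1 - w x) • fderiv ℝ χ x)).trans ?_
      rw [enorm_smul, enorm_smul, enorm_neg, add_comm]
      refine add_le_add (mul_le_of_le_one_left' (henorm ?_))
        (mul_le_of_le_one_left' (henorm (hχr x)))
      exact ⟨by linarith [(hwr x).2], by linarith [(hwr x).1]⟩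
    have hval : ∫⁻ x, ‖χ x‖ₑ ^ p ≤
        2 ^ (p - 1) * ((∫⁻ x, ‖χ x * (1 - w x)‖ₑ ^ p) + A' * δ) := by
      refine le_trans ?_ (mul_le_mul' le_rfl (add_le_add le_rfl hw0))
      rw [← lintegral_add_left ((hvs.continuous.enorm.measurable).pow_const p),
        ← lintegral_const_mul' _ _ h2t]
      refine lintegral_mono fun x => le_trans ?_ (ENNReal.rpow_add_le_mul_rpow_add_rpow _ _ hp)
      refine ENNReal.rpow_le_rpow ?_ hp0.le
      calc ‖χ x‖ₑ = ‖χ x * (1 - w x) + χ x * w x‖ₑ := by ring_nf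
        _ ≤ ‖χ x * (1 - w x)‖ₑ + ‖χ x * w x‖ₑ := enorm_add_le _ _
        _ ≤ _ := by
          gcongr
          rw [enorm_mul]
          exact mul_le_of_le_one_left' (henorm (hχr x))
    calc _ ≤ ℓ * (2 ^ (p - 1) * ((∫⁻ x, ‖χ x * (1 - w x)‖ₑ ^ p) + A' * δ)) := by gcongr
      _ = 2 ^ (p - 1) * (ℓ * (∫⁻ x, ‖χ x * (1 - w x)‖ₑ ^ p) + ℓ * (A' * δ)) := by ring
      _ ≤ 2 ^ (p - 1) * (D * (2 ^ (p - 1) * (G + A' * δ)) + A' * δ) := by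
        refine mul_le_mul' le_rfl (add_le_add ?_ (mul_le_of_le_one_left' (min_le_right _ _)))
        exact (mul_le_mul' (min_le_left _ _) le_rfl).trans (hv.trans (mul_le_mul' le_rfl hgrad))
      _ = _ := by rw [hb]; ring
  -- With `χ` fixed, so are `I` and `b`; zero capacity then yields a competitor of energy below `ε /
  -- b`.
  refine ENNReal.le_of_forall_pos_le_add fun ε hε _ => ?_
  obtain ⟨u, hu, huK, hlt⟩ := exists_relCapacity_competitor h0
    (ENNReal.div_pos (ENNReal.coe_pos.2 hε).ne' hbt)
  refine (main u hu huK).trans (add_le_add le_rfl ?_)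
  exact (mul_le_mul' le_rfl hlt.le).trans ENNReal.mul_div_le

theorem poincareConst_eq_zero_of_relCapacity_eq_zero (hN : 0 < N) (hp : 1 ≤ p)
    (hΩ : IsPeriodicallyPerforated t K Ω) (h0 : relCapacity p K (cube N 1) = 0) :
    poincareConst p Ω = 0 := by
  have hp0 : 0 < p := by linarith
  obtain ⟨B, hB, h⟩ := exists_poincareConst_mul_lintegral_le_of_relCapacity_eq_zero hN hp hΩ h0
  obtain ⟨η, hη, hη1, hηr⟩ := exists_cutoff N
  set X := ∫⁻ x, ‖η x‖ₑ ^ p with hX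
  set G := ∫⁻ x, ‖fderiv ℝ η x‖ₑ ^ p with hG
  have hGt : G ≠ ⊤ := (lintegral_enorm_rpow_lt_top (hη.1.continuous_fderiv (by simp))
    (hη.2.1.fderiv ℝ) hp0).ne
  have hX0 : X ≠ 0 := by
    have : volume (cube N (1 / 2)) ≤ X := by
      rw [← setLIntegral_one]
      refine le_trans (setLIntegral_mono' (isOpen_cube _).measurableSet fun x hx => ?_)
        (setLIntegral_le_lintegral (cube N (1 / 2)) _)
      simp [hη1 x (subset_closure hx)]
    intro hX
    exact volume_cube_ne_zero (by norm_num) (le_antisymm (this.trans hX.le) zero_le)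
  set ℓ := min (poincareConst p Ω) 1 with hℓ
  have hscale : ∀ n : ℕ, ℓ * X ≤ B * G * ((n + 1 : ℕ) : ℝ≥0∞)⁻¹ := by
    intro n
    set R : ℝ := ((n + 1 : ℕ) : ℝ) with hR
    have hR0 : 0 < R := by rw [hR]; positivity
    have hR1 : 1 ≤ R := by rw [hR]; simp
    set e : EuclideanSpace ℝ (Fin N) ≃L[ℝ] EuclideanSpace ℝ (Fin N) :=
      ContinuousLinearEquiv.smulLeft (Units.mk0 R⁻¹ (inv_ne_zero hR0.ne')) with he
    have hev : ∀ x, e x = R⁻¹ • x := fun x => rfl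
    have hnorm : ‖(e : EuclideanSpace ℝ (Fin N) →L[ℝ] EuclideanSpace ℝ (Fin N))‖ₑ ≤
        ((n + 1 : ℕ) : ℝ≥0∞)⁻¹ := by
      rw [← ofReal_norm]
      calc _ ≤ ENNReal.ofReal R⁻¹ := by
            refine ENNReal.ofReal_le_ofReal
              (ContinuousLinearMap.opNorm_le_bound _ (by positivity) fun x => ?_)
            change ‖R⁻¹ • x‖ ≤ _
            rw [norm_smul, Real.norm_of_nonneg (by positivity)]
        _ = _ := by rw [ENNReal.ofReal_inv_of_pos hR0, hR, ENNReal.ofReal_natCast]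
    obtain ⟨k, hk0, hkt, hk⟩ := exists_lintegral_comp_equiv volume e
    have key := h (fun x => η (e x)) (hη.1.comp e.contDiff)
      (hη.2.1.comp_homeomorph e.toHomeomorph) fun x => hηr _
    have h2 := lintegral_enorm_fderiv_comp_equiv_le volume (hη.1.of_le (by simp)) e hp0.le
    rw [hk fun x => ‖fderiv ℝ η x‖ₑ ^ p, ← hG] at h2
    rw [hk fun x => ‖η x‖ₑ ^ p, ← hX] at key
    -- The true decay is `R ^ (-p)`; as `p ≥ 1` and `R ≥ 1`, the weaker `R⁻¹` holds and suffices for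
    -- the limit.
    have hpow : ‖(e : EuclideanSpace ℝ (Fin N) →L[ℝ] EuclideanSpace ℝ (Fin N))‖ₑ ^ p ≤
        ((n + 1 : ℕ) : ℝ≥0∞)⁻¹ := by
      refine (ENNReal.rpow_le_rpow hnorm hp0.le).trans
        ((ENNReal.rpow_le_rpow_of_exponent_ge ?_ hp).trans_eq (ENNReal.rpow_one _))
      simp
    refine (ENNReal.mul_le_mul_iff_right hk0 hkt).1 ?_
    calc k * (ℓ * X) = ℓ * (k * X) := by ring
      _ ≤ B * (((n + 1 : ℕ) : ℝ≥0∞)⁻¹ * (k * G)) :=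
        key.trans (mul_le_mul' le_rfl (h2.trans (mul_le_mul' hpow le_rfl)))
      _ = _ := by ring
  have hlim : Filter.Tendsto (fun n : ℕ => B * G * ((n + 1 : ℕ) : ℝ≥0∞)⁻¹) Filter.atTop
      (nhds 0) := by
    have := ENNReal.Tendsto.const_mul (a := B * G)
      (ENNReal.tendsto_inv_nat_nhds_zero.comp (Filter.tendsto_add_atTop_nat 1))
      (.inr (ENNReal.mul_ne_top hB hGt))
    rwa [mul_zero] at this
  have hzero : ℓ * X = 0 := le_antisymm (ge_of_tendsto' hlim hscale) zero_le
  have hℓ0 : ℓ = 0 := (mul_eq_zero.1 hzero).resolve_right hX0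
  rcases min_choice (poincareConst p Ω) 1 with hc | hc
  · rw [← hc, ← hℓ, hℓ0]
  · rw [← hℓ, hℓ0] at hc
    exact absurd hc zero_ne_one

end Perforated

theorem mainTheorem3 (N : ℕ) (hN : 2 ≤ N) (p : ℝ) (hp : 1 ≤ p) :
    ∃ c : ℝ, 0 < c ∧
      ∀ (t : Fin N → ℝ) (K Ω : Set (EuclideanSpace ℝ (Fin N))),
        Perforated.IsPeriodicallyPerforated t K Ω →
        (0 < Perforated.poincareConst p Ω ↔
          0 < Perforated.relCapacity p K (Perforated.cube N 1)) ∧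
        ENNReal.ofReal (c * (1 / (⨆ j, t j)) ^ p) *
            Perforated.relCapacity p K (Perforated.cube N 1) ≤
          Perforated.poincareConst p Ω := by
  have hN0 : 0 < N := by omega
  obtain ⟨c, hc, h⟩ := Perforated.exists_ofReal_mul_relCapacity_le_poincareConst hN0 hp
  refine ⟨c, hc, fun t K Ω hΩ => ?_⟩
  obtain ⟨hT, hle⟩ := h t K Ω hΩ
  refine ⟨⟨fun hpos => ?_, fun hpos => ?_⟩, hle⟩
  · rw [pos_iff_ne_zero] at hpos ⊢
    exact mt (Perforated.poincareConst_eq_zero_of_relCapacity_eq_zero hN0 hp hΩ) hpos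
  · refine lt_of_lt_of_le (ENNReal.mul_pos ?_ hpos.ne') hle
    rw [ne_eq, ENNReal.ofReal_eq_zero, not_le]
    positivity
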